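/- **Theorem 8.3.** Let $n, N \ge 0$, let $\lambda=(\lambda_1\ge\dots\ge\lambda_n\ge 0)$ be a partition of length at most $n$, let $\rho=(n,n-1,\dots,1)$, and assume $N\ge(\lambda+\rho)_i$ for all $i$. Let $t$, pairwise distinct $x_1,\dots,x_n$, and $y_1,y_2,\dots$ be elements of a field (for instance, independent indeterminates, in the field of rational functions in them). Then for every $\sigma\in S_n$ $$\sum_{w\in S_n}\Omega^{\lambda+\rho}_{\sigma,w}(\boldsymbol x;\boldsymbol y)=\Bigl(\prod_{1\le i<j\le n}(x_i-t\,x_j)\Bigr)\,s_\lambda(x|y),$$ where $s_\lambda(x|y)$ is the factorial Schur function $$s_\lambda(x|y)=\frac{\det\bigl((x_i+y_1)(x_i+y_2)\cdots(x_i+y_{\lambda_j+n-j})\bigr)_{1\le i,j\le n}}{\prod_{i<j}(x_i-x_j)} .$$ Here, for $\mu_1\ge\dots\ge\mu_n>0$ with $\mu_1\le N$ and $\sigma,w\in S_n$, $\Omega^{\mu}_{\sigma,w}(\boldsymbol x;\boldsymbol y)$ is the partition function of the following lattice model. The grid has $n$ rows, numbered from top to bottom, and $N$ columns, numbered $1,\dots,N$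 from right to left. There are $n$ colors $1<2<\dots<n$. Each horizontal edge is decorated by a color or by $+$ (no color), each vertical edge by a set of colors. On the top boundary, the edge in column $\mu_i$ carries the color $\sigma(n+1-i)$ for each $i$, and there are no other colors; the right boundary edge in row $i$ has the color $w(i)$; the left and bottom boundary edges are uncolored. A state is a decoration with this boundary in which the decorations (left, top, right, bottom) at every vertex are in the following list. The weight of a state is the product over all vertices of the weights below, with $x=x_i$, $y=y_j$ at row $i$ and column $j$, and $\Omega^\mu_{\sigma,w}$ is the sum of the weights of all states. For a set $\Sigma$ of colors and an interval $I$ we write $\Sigma_I=|\Sigma\cap I|$, and $c<d$ are colors: 1. $(+,\Sigma,+,\Sigma)$: $(-t)^{|\Sigma|}$; 2. $(c,\Sigma,c,\Sigma)$: $t^{\Sigma_{(c,n]}}\,(x+t^{\Sigma_{\{c\}}}y)$; 3. $(+,\Sigma,c,\Sigma\setminus\{c\})$ with $c\in\Sigma$: $(-t)^{\Sigma_{[1,c)}}\,t^{\Sigma_{(c,n]}}$; 4. $(c,\Sigma,+,\Sigma\cup\{c\})$ with $c\notin\Sigma$: $(1-t)\,x\,(-t)^{\Sigma_{(c,n]}}$;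 5. $(c,\Sigma,d,(\Sigma\cup\{c\})\setminus\{d\})$ with $c\notin\Sigma$, $d\in\Sigma$: $(1-t)\,x\,(-t)^{\Sigma_{(c,d)}}\,t^{\Sigma_{(d,n]}}$; 6. $(d,\Sigma,c,(\Sigma\cup\{d\})\setminus\{c\})$ with $d\notin\Sigma$, $c\in\Sigma$: $(t-1)\,y\,(-1)^{\Sigma_{(c,d)}}\,t^{\Sigma_{(d,n]}}$. -/

import Mathlib

/-
Conventions.  The grid has `n` rows and `N` columns.  Rows are numbered from top to bottom; row
number `i + 1` is indexed by `i : Fin n`.  Columns are numbered from right to left, starting at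
one; column number `j + 1` is indexed by `j : Fin N`.  The colors `c_1 < ... < c_n` are the
elements of `Fin n` in their usual order.  Row `i` carries the parameter `x i`, and the column
with number `k` carries the parameter `y k`, for `1 ≤ k ≤ N` (the value `y 0` is never used).
-/

namespace DoubleWhittaker

/-- Decorations of horizontal edges: a color, or no color (`none`, written `⊕` or `+`). -/
abbrev HSpin (n : ℕ) : Type := Option (Fin n)

/-- Decorations of vertical edges: a set of colors. -/
abbrev VSpin (n : ℕ) : Type := Finset (Fin n)

/-- The six admissible configurations at a vertex with left, top, right and bottom decorations
`l`, `Σ = top`, `r`, `bot`.  In this order: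
* Case 1: `(+, Σ, +, Σ)`;
* Case 4: `(c, Σ, +, Σ ∪ {c})` with `c ∉ Σ`;
* Case 3: `(+, Σ, c, Σ \ {c})` with `c ∈ Σ`;
* Case 2: `(c, Σ, c, Σ)`;
* Cases 5 and 6: `(c, Σ, d, (Σ ∪ {c}) \ {d})` with `c ≠ d`, `c ∉ Σ`, `d ∈ Σ`. -/
def AdmissibleVertex {n : ℕ} (l : HSpin n) (top : VSpin n) (r : HSpin n) (bot : VSpin n) : Prop :=
  match l, r with
  | none, none => bot = top
  | some c, none => c ∉ top ∧ bot = insert c top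
  | none, some c => c ∈ top ∧ bot = top.erase c
  | some c, some d =>
      if c = d then bot = top else c ∉ top ∧ d ∈ top ∧ bot = (insert c top).erase d

instance {n : ℕ} (l : HSpin n) (top : VSpin n) (r : HSpin n) (bot : VSpin n) :
    Decidable (AdmissibleVertex l top r bot) := by
  unfold AdmissibleVertex
  split <;> infer_instance

/-- The Whittaker Boltzmann weight of an admissible vertex with row parameter `x` and column
parameter `y`.  It is a function of the left, top and right decorations, which determine the
bottom decoration of an admissible vertex. -/
def whittakerWeight {K : Type*} [Field K] {n : ℕ} (t x y : K)
    (l : HSpin n) (S : VSpin n) (r : HSpin n) : K :=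
  match l, r with
  -- Case 1
  | none, none => (-t) ^ S.card
  -- Case 4
  | some c, none => (1 - t) * x * (-t) ^ (S.filter (fun e => c < e)).card
  -- Case 3
  | none, some c =>
      (-t) ^ (S.filter (fun e => e < c)).card * t ^ (S.filter (fun e => c < e)).card
  | some c, some d =>
      -- Case 2
      if c = d then
        t ^ (S.filter (fun e => c < e)).card * (x + t ^ (if c ∈ S then 1 else 0) * y)
      -- Case 5
      else if c < d then
        (1 - t) * x * (-t) ^ (S.filter (fun e => c < e ∧ e < d)).card
          * t ^ (S.filter (fun e => d < e)).card
      -- Case 6, where `d < c`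
      else
        (t - 1) * y * (-1) ^ (S.filter (fun e => d < e ∧ e < c)).card
          * t ^ (S.filter (fun e => c < e)).card

/-- A decorated grid: a decoration of each horizontal edge and of each vertical edge.
* `s.1 i k` decorates the edge of row `i` that has exactly `k` columns to its right; so `k = 0` is
  the right boundary edge, and `k = N` is the left boundary edge;
* `s.2 k j` decorates the edge of column `j` that has exactly `k` rows above it; so `k = 0` is the
  top boundary edge, and `k = n` is the bottom boundary edge. -/
abbrev DecoratedGrid (n N : ℕ) : Type :=
  (Fin n → Fin (N + 1) → HSpin n) × (Fin (n + 1) → Fin N → VSpin n)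

/-- A choice of decoration for each boundary edge. -/
structure Boundary (n N : ℕ) where
  top : Fin N → VSpin n
  right : Fin n → HSpin n
  bottom : Fin N → VSpin n
  left : Fin n → HSpin n

/-- `s` is an admissible state with boundary decorations `B`. -/
def IsAdmissibleState {n N : ℕ} (B : Boundary n N) (s : DecoratedGrid n N) : Prop :=
  (∀ j, s.2 0 j = B.top j) ∧ (∀ i, s.1 i 0 = B.right i) ∧
  (∀ j, s.2 (Fin.last n) j = B.bottom j) ∧ (∀ i, s.1 i (Fin.last N) = B.left i) ∧
  ∀ (i : Fin n) (j : Fin N),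
    AdmissibleVertex (s.1 i j.succ) (s.2 i.castSucc j) (s.1 i j.castSucc) (s.2 i.succ j)

instance {n N : ℕ} (B : Boundary n N) : DecidablePred (IsAdmissibleState B) := by
  intro s
  unfold IsAdmissibleState
  infer_instance

/-- The partition function with Whittaker weights: the sum over the admissible states with boundary
`B` of the product of the Boltzmann weights of all vertices. -/
def partitionFunction {K : Type*} [Field K] {n N : ℕ} (t : K) (x : Fin n → K) (y : ℕ → K)
    (B : Boundary n N) : K :=
  ∑ s : DecoratedGrid n N with IsAdmissibleState B s,
    ∏ i : Fin n, ∏ j : Fin N,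
      whittakerWeight t (x i) (y ((j : ℕ) + 1))
        (s.1 i j.succ) (s.2 i.castSucc j) (s.1 i j.castSucc)

/-- The boundary conditions `B(σ, w, μ)`: on the top boundary, the edge in column number `μ_i`
carries the color `σ(n + 1 - i)`, for each `i`; on the right boundary, the edge in row `i` has the
color `w(i)`; the bottom and left boundaries are uncolored. -/
def boundary {n : ℕ} (N : ℕ) (σ w : Equiv.Perm (Fin n)) (μ : Fin n → ℕ) : Boundary n N where
  top j := (Finset.univ.filter (fun i : Fin n => μ i = (j : ℕ) + 1)).image (fun i => σ i.rev)
  right i := some (w i)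
  bottom _ := ∅
  left _ := none

/-- The partition function `Ω^μ_{σ,w}(x; y)` of the Whittaker model with `N` columns. -/
def Omega {K : Type*} [Field K] {n : ℕ} (N : ℕ) (t : K) (x : Fin n → K) (y : ℕ → K)
    (σ w : Equiv.Perm (Fin n)) (μ : Fin n → ℕ) : K :=
  partitionFunction t x y (boundary N σ w μ)

/-- The Weyl vector `ρ = (n, n - 1, ..., 1)`, normalized for columns that are numbered from one. -/
def rho (n : ℕ) : Fin n → ℕ := fun i => n - (i : ℕ)

/-- The factorial power `(u|y)^m = (u + y_1)(u + y_2) ⋯ (u + y_m)`. -/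
def factorialPower {K : Type*} [Field K] (y : ℕ → K) (u : K) (m : ℕ) : K :=
  ∏ k ∈ Finset.Icc 1 m, (u + y k)

/-- The factorial Schur function
`s_λ(x|y) = det ((x_i|y)^(λ_j + n - j))_{1 ≤ i, j ≤ n} / ∏_{i < j} (x_i - x_j)`,
for pairwise distinct `x_i`. -/
def factorialSchur {K : Type*} [Field K] {n : ℕ} (lam : Fin n → ℕ) (x : Fin n → K) (y : ℕ → K) :
    K :=
  (Matrix.of (fun i j : Fin n =>
      factorialPower y (x i) (lam j + (n - ((j : ℕ) + 1))))).det
    / ∏ i : Fin n, ∏ j ∈ Finset.Ioi i, (x i - x j)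

end DoubleWhittaker

/-! Once the colors on the right boundary are summed over, the model becomes color-blind and is
governed by an exterior algebra. With rows `x₁, …, x_k` left, give a color in column `m + 1` the
vector `((x_i|y)^m)_i` of `K^k`, give an edge with several colors the value 0, and take the ordered
product from left to right. The weights summed over the outputs of a vertex then depend only on the
number of colors on each incoming edge, and vanish if at least two colors enter from above
(`vertexSum_eq_zero`).

So a whole row acts linearly on these products (`rowTransfer_eq`): it contracts with the first
coordinate, deletes that coordinate, and scales the `j`-th one by `(x₁ - t x_j)/(x₁ - x_j)`.
Iterating down to `K^0`, whose exterior algebra is `K`, writes the summed partition function as a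
linear functional of the product for the top boundary (`gridSum_eq`).

On wedges of `n` vectors of `K^n` this functional is alternating, hence a multiple of the
determinant; its value on the standard basis gives the product of `(x_i - t x_j)/(x_i - x_j)`
(`gridFunctional_ιMulti`). The top boundary gives the wedge of the vectors of exponents `λ_j + n -
j`, whatever `σ` is, so the determinant is the numerator of the factorial Schur function. Color
conservation restricts the right boundary to permutations. -/

namespace DoubleWhittaker

/-! ### Summation over the outputs of a vertex -/

section HorizontalEdge

variable {A : Type*} {n : ℕ}

/-- The element attached to a horizontal edge: `g₀` for no color, `g₁` for a color. -/
def hValue (g₀ g₁ : A) (h : HSpin n) : A :=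
  if h.isSome then g₁ else g₀

@[simp] lemma hValue_none (g₀ g₁ : A) : hValue g₀ g₁ (none : HSpin n) = g₀ := rfl

@[simp] lemma hValue_some (g₀ g₁ : A) (c : Fin n) : hValue g₀ g₁ (some c) = g₁ := rfl

end HorizontalEdge

section Vertex

variable {K : Type*} [Field K] {A : Type*} [Ring A] [Algebra K A] {n : ℕ}

/-- The Boltzmann weight of a vertex, extended by zero to all configurations. -/
def vertexWeight (t x y : K) (l : HSpin n) (S : VSpin n) (r : HSpin n) (b : VSpin n) : K :=
  if AdmissibleVertex l S r b then whittakerWeight t x y l S r else 0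

/-- The element attached to a vertical edge: `1` for no color, `a` for one color, and `0` for
several colors. -/
def occupation (a : A) (S : VSpin n) : A :=
  if S.card = 0 then 1 else if S.card = 1 then a else 0

@[simp] lemma occupation_empty (a : A) : occupation a (∅ : VSpin n) = 1 := by simp [occupation]

@[simp] lemma occupation_singleton (a : A) (c : Fin n) :
    occupation a ({c} : VSpin n) = a := by simp [occupation]

lemma occupation_eq_zero (a : A) {S : VSpin n} (hS : 2 ≤ S.card) : occupation a S = 0 := by
  rw [occupation, if_neg (by omega), if_neg (by omega)]

lemma sum_vertexWeight_none_none (t x y : K) (S : VSpin n) (f : VSpin n → A) :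
    ∑ b, vertexWeight t x y none S none b • f b = (-t) ^ S.card • f S := by
  rw [Finset.sum_eq_single S (fun b _ hb => by simp [vertexWeight, AdmissibleVertex, hb])
    (by simp)]
  simp [vertexWeight, AdmissibleVertex, whittakerWeight]

lemma sum_vertexWeight_none_some (t x y : K) (S : VSpin n) (c : Fin n) (f : VSpin n → A) :
    ∑ b, vertexWeight t x y none S (some c) b • f b =
      if c ∈ S then whittakerWeight t x y none S (some c) • f (S.erase c) else 0 := by
  split_ifs with h <;> simp [vertexWeight, AdmissibleVertex, ite_smul, h]

lemma sum_vertexWeight_some_none (t x y : K) (S : VSpin n) (c : Fin n) (f : VSpin n → A) :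
    ∑ b, vertexWeight t x y (some c) S none b • f b =
      if c ∉ S then whittakerWeight t x y (some c) S none • f (insert c S) else 0 := by
  split_ifs with h <;> simp [vertexWeight, AdmissibleVertex, ite_smul, h]

lemma sum_vertexWeight_some_self (t x y : K) (S : VSpin n) (c : Fin n) (f : VSpin n → A) :
    ∑ b, vertexWeight t x y (some c) S (some c) b • f b =
      whittakerWeight t x y (some c) S (some c) • f S := by
  simp [vertexWeight, AdmissibleVertex, ite_smul]

lemma sum_vertexWeight_some_some (t x y : K) (S : VSpin n) {c d : Fin n} (hcd : c ≠ d)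
    (f : VSpin n → A) :
    ∑ b, vertexWeight t x y (some c) S (some d) b • f b =
      if c ∉ S ∧ d ∈ S then whittakerWeight t x y (some c) S (some d) • f ((insert c S).erase d)
      else 0 := by
  by_cases h : c ∉ S ∧ d ∈ S
  · simp [vertexWeight, AdmissibleVertex, ite_smul, h, hcd]
  · have h' : ∀ b, ¬ (c ∉ S ∧ d ∈ S ∧ b = (insert c S).erase d) := fun b hb => h ⟨hb.1, hb.2.1⟩
    simp [vertexWeight, AdmissibleVertex, hcd, h', h]

/-- The sum over the outputs of a vertex, with values `a` and `g₀`, `g₁` attached to the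
bottom and right edges. -/
def vertexSum (t x y : K) (a g₀ g₁ : A) (l : HSpin n) (S : VSpin n) : A :=
  ∑ h, ∑ b, vertexWeight t x y l S h b • (occupation a b * hValue g₀ g₁ h)

lemma vertexSum_none_empty (t x y : K) (a g₀ g₁ : A) :
    vertexSum t x y a g₀ g₁ none (∅ : VSpin n) = g₀ := by
  rw [vertexSum, Fintype.sum_option]
  simp only [sum_vertexWeight_none_none t x y ∅ fun b => occupation a b * _,
    sum_vertexWeight_none_some t x y ∅ _ fun b => occupation a b * _]
  simp

lemma vertexSum_none_singleton (t x y : K) (a g₀ g₁ : A) (d : Fin n) :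
    vertexSum t x y a g₀ g₁ none ({d} : VSpin n) = -(t • (a * g₀)) + g₁ := by
  rw [vertexSum, Fintype.sum_option]
  simp only [sum_vertexWeight_none_none t x y {d} fun b => occupation a b * _,
    sum_vertexWeight_none_some t x y {d} _ fun b => occupation a b * _]
  simp [whittakerWeight, Finset.filter_singleton]

lemma vertexSum_some_empty (t x y : K) (a g₀ g₁ : A) (c : Fin n) :
    vertexSum t x y a g₀ g₁ (some c) (∅ : VSpin n) =
      ((1 - t) * x) • (a * g₀) + (x + y) • g₁ := by
  rw [vertexSum, Fintype.sum_option, Finset.sum_eq_single c]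
  · simp only [sum_vertexWeight_some_none t x y ∅ _ fun b => occupation a b * _,
      sum_vertexWeight_some_self t x y ∅ _ fun b => occupation a b * _]
    simp [whittakerWeight]
  · intro d _ hd
    simp [sum_vertexWeight_some_some t x y ∅ hd.symm fun b => occupation a b * _]
  · simp

/-- The cases `c = d`, `c < d` and `c > d` agree: `x + ty = t(x + y) + (1 - t)x = (x + y) + (t -
1)y`. An uncolored output would leave two colors below, of value 0. -/
lemma vertexSum_some_singleton (t x y : K) (a g₀ g₁ : A) (c d : Fin n) :
    vertexSum t x y a g₀ g₁ (some c) ({d} : VSpin n) = (x + t * y) • (a * g₁) := by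
  rw [vertexSum, Fintype.sum_option]
  simp only [sum_vertexWeight_some_none t x y {d} _ fun b => occupation a b * _]
  rcases eq_or_ne c d with rfl | hcd
  · rw [Finset.sum_eq_single c]
    · simp only [sum_vertexWeight_some_self t x y {c} _ fun b => occupation a b * _]
      simp [whittakerWeight, Finset.filter_singleton]
    · intro e _ he
      simp [sum_vertexWeight_some_some t x y {c} he.symm fun b => occupation a b * _]
    · simp
  · have hcard : 2 ≤ (insert c {d} : VSpin n).card := by rw [Finset.card_pair hcd]
    have herase : (insert c {d} : VSpin n).erase d = {c} := by
      ext e; simp only [Finset.mem_erase, Finset.mem_insert, Finset.mem_singleton]; grind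
    rw [Fintype.sum_eq_add c d hcd]
    · simp only [sum_vertexWeight_some_self t x y {d} _ fun b => occupation a b * _,
        sum_vertexWeight_some_some t x y {d} hcd fun b => occupation a b * _,
        occupation_eq_zero a hcard, herase]
      rcases hcd.lt_or_gt with h | h
      · simp [whittakerWeight, Finset.filter_singleton, hcd, h, ← add_smul]
        congr 1; ring
      · simp [whittakerWeight, Finset.filter_singleton, hcd, h, not_lt_of_gt h, ← add_smul]
        congr 1; ring
    · intro e he
      simp [sum_vertexWeight_some_some t x y {d} he.1.symm fun b => occupation a b * _, he.2]

/-- At least two colors remain below, except when exactly two enter from above and none from the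
left. This makes the value 0 for several colors consistent from row to row. -/
lemma vertexSum_eq_zero (t x y : K) (a g₀ g₁ : A) (l : HSpin n) {S : VSpin n} (hS : 2 ≤ S.card) :
    vertexSum t x y a g₀ g₁ l S = 0 := by
  rw [vertexSum, Fintype.sum_option]
  rcases l with _ | c
  · simp only [sum_vertexWeight_none_none t x y S fun b => occupation a b * _,
      sum_vertexWeight_none_some t x y S _ fun b => occupation a b * _, occupation_eq_zero a hS,
      zero_mul, smul_zero, zero_add, hValue_some]
    rcases hS.eq_or_lt with h | h
    · obtain ⟨p, q, hpq, rfl⟩ : ∃ p q, p < q ∧ S = {p, q} := by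
        obtain ⟨p, q, hpq, rfl⟩ := Finset.card_eq_two.1 h.symm
        rcases hpq.lt_or_gt with h | h
        · exact ⟨p, q, h, rfl⟩
        · exact ⟨q, p, h, Finset.pair_comm p q⟩
      have hp : ({p, q} : VSpin n).erase p = {q} := by ext e; simp; grind
      have hq : ({p, q} : VSpin n).erase q = {p} := by ext e; simp; grind
      -- The outputs `p` and `q` have weights `t` and `-t`, which cancel.
      rw [Fintype.sum_eq_add p q hpq.ne]
      · simp [hp, hq, whittakerWeight, Finset.filter_insert, Finset.filter_singleton, hpq,
          not_lt_of_gt hpq]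
      · intro e he
        simp [he.1, he.2]
    · refine Finset.sum_eq_zero fun c _ => ?_
      split_ifs with hc
      · rw [occupation_eq_zero a (by rw [Finset.card_erase_of_mem hc]; omega), zero_mul, smul_zero]
      · rfl
  · rw [sum_vertexWeight_some_none t x y S _ fun b => occupation a b * _,
      occupation_eq_zero a (hS.trans (Finset.card_le_card (Finset.subset_insert c S))),
      Finset.sum_eq_zero]
    · simp
    · intro d _
      rcases eq_or_ne c d with rfl | hcd
      · rw [sum_vertexWeight_some_self t x y S _ fun b => occupation a b * _,
          occupation_eq_zero a hS, zero_mul, smul_zero]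
      · rw [sum_vertexWeight_some_some t x y S hcd fun b => occupation a b * _]
        split_ifs with h
        · rw [occupation_eq_zero a, zero_mul, smul_zero]
          rw [Finset.card_erase_of_mem (Finset.mem_insert_of_mem h.2),
            Finset.card_insert_of_notMem h.1]
          omega
        · rfl

end Vertex

/-! ### Sums over the states of a row and of a grid -/

section Grid

variable {K : Type*} [Field K] {n : ℕ}

/-- The sum over all decorations of the horizontal edges of a row with left boundary `l`
and with an arbitrary color on the right boundary. -/
def rowSum (t x : K) (y : ℕ → K) (N : ℕ) (l : HSpin n) (top bot : Fin N → VSpin n) : K :=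
  ∑ h : Fin (N + 1) → HSpin n, if h (Fin.last N) = l then
    hValue 0 1 (h 0) * ∏ j : Fin N,
      vertexWeight t x (y (j + 1)) (h j.succ) (top j) (h j.castSucc) (bot j) else 0

lemma rowSum_zero (t x : K) (y : ℕ → K) (l : HSpin n) (top bot : Fin 0 → VSpin n) :
    rowSum t x y 0 l top bot = hValue 0 1 l := by
  rw [rowSum, ← (Equiv.funUnique (Fin 1) (HSpin n)).symm.sum_comp]
  simp

lemma rowSum_succ (t x : K) (y : ℕ → K) (N : ℕ) (l : HSpin n) (top bot : Fin (N + 1) → VSpin n) :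
    rowSum t x y (N + 1) l top bot =
      ∑ h, vertexWeight t x (y (N + 1)) l (top (Fin.last N)) h (bot (Fin.last N)) *
        rowSum t x y N h (Fin.init top) (Fin.init bot) := by
  rw [rowSum, ← (Fin.snocEquiv fun _ => HSpin n).sum_comp, Fintype.sum_prod_type]
  simp only [Fin.snocEquiv_apply, Fin.snoc_last]
  rw [Finset.sum_eq_single l (fun b _ hb => by simp [hb]) (by simp)]
  simp only [rowSum, Finset.mul_sum]
  rw [Finset.sum_comm]
  refine Finset.sum_congr rfl fun g _ => ?_
  rw [Finset.sum_eq_single (g (Fin.last N)) (fun b _ hb => by simp [hb.symm]) (by simp)]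
  rw [if_pos trivial, if_pos rfl, Fin.prod_univ_castSucc]
  have h0 : (Fin.snoc g l : Fin (N + 1 + 1) → HSpin n) 0 = g 0 := by
    rw [← Fin.castSucc_zero, Fin.snoc_castSucc (α := fun _ => HSpin n)]
  simp only [h0, Fin.succ_last, Fin.snoc_last, Fin.snoc_castSucc (α := fun _ => HSpin n),
    Fin.succ_castSucc, Fin.init, Fin.val_castSucc, Fin.val_last]
  ring

/-- The sum over all states of a grid with given top boundary, uncolored left and bottom
boundaries, and with arbitrary colors on the right boundary. -/
def gridSum (t : K) (y : ℕ → K) (N : ℕ) {k : ℕ} (x : Fin k → K) (top : Fin N → VSpin n) : K :=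
  ∑ v : Fin (k + 1) → Fin N → VSpin n, if v 0 = top ∧ v (Fin.last k) = fun _ => ∅ then
    ∏ i : Fin k, rowSum t (x i) y N none (v i.castSucc) (v i.succ) else 0

lemma gridSum_zero (t : K) (y : ℕ → K) (N : ℕ) (x : Fin 0 → K) (top : Fin N → VSpin n) :
    gridSum t y N x top = if top = fun _ => ∅ then 1 else 0 := by
  rw [gridSum, ← (Equiv.funUnique (Fin 1) (Fin N → VSpin n)).symm.sum_comp,
    Finset.sum_eq_single top]
  · simp
  · intro b _ hb
    simp [hb]
  · simp

lemma gridSum_succ (t : K) (y : ℕ → K) (N : ℕ) {k : ℕ} (x : Fin (k + 1) → K)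
    (top : Fin N → VSpin n) :
    gridSum t y N x top =
      ∑ bot, rowSum t (x 0) y N none top bot * gridSum t y N (Fin.tail x) bot := by
  rw [gridSum, ← (Fin.consEquiv fun _ => Fin N → VSpin n).sum_comp, Fintype.sum_prod_type]
  simp only [Fin.consEquiv_apply, Fin.cons_zero]
  rw [Finset.sum_eq_single top (fun b _ hb => by simp [hb]) (by simp)]
  simp only [gridSum, Finset.mul_sum]
  rw [Finset.sum_comm]
  refine Finset.sum_congr rfl fun v _ => ?_
  rw [Finset.sum_eq_single (v 0) (fun b _ hb => by simp [hb.symm]) (by simp)]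
  simp only [true_and, ← Fin.succ_last, Fin.cons_succ, Fin.prod_univ_succ, Fin.castSucc_zero,
    Fin.cons_zero, ← Fin.succ_castSucc, mul_ite, mul_zero, Fin.tail]

end Grid

/-! ### The row transfer in the exterior algebra -/

section Row

variable {K : Type*} [Field K] {n : ℕ}

/-- The ordered product, from left to right, of the elements attached to the vertical edges,
where `v j` is attached to a color in column `j + 1`. -/
def occupationProd {A : Type*} [Ring A] (v : ℕ → A) : (N : ℕ) → (Fin N → VSpin n) → A
  | 0, _ => 1
  | N + 1, S => occupation (v N) (S (Fin.last N)) * occupationProd v N (Fin.init S)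

/-- The sum over the states of a row with given left and top boundary, where each configuration of
the bottom edges contributes its ordered product. -/
def rowTransfer {A : Type*} [Ring A] [Algebra K A] (t x : K) (y : ℕ → K) (v : ℕ → A) (N : ℕ)
    (l : HSpin n) (top : Fin N → VSpin n) : A :=
  ∑ bot, rowSum t x y N l top bot • occupationProd v N bot

lemma rowTransfer_zero {A : Type*} [Ring A] [Algebra K A] (t x : K) (y : ℕ → K) (v : ℕ → A)
    (l : HSpin n) (top : Fin 0 → VSpin n) : rowTransfer t x y v 0 l top = hValue 0 1 l := by
  rw [rowTransfer, Fintype.sum_unique, rowSum_zero, occupationProd]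
  cases l <;> simp

lemma rowTransfer_succ {A : Type*} [Ring A] [Algebra K A] (t x : K) (y : ℕ → K) (v : ℕ → A)
    (N : ℕ) (l : HSpin n) (top : Fin (N + 1) → VSpin n) :
    rowTransfer t x y v (N + 1) l top =
      ∑ h, ∑ b, vertexWeight t x (y (N + 1)) l (top (Fin.last N)) h b •
        (occupation (v N) b * rowTransfer t x y v N h (Fin.init top)) := by
  rw [rowTransfer, ← (Fin.snocEquiv fun _ => VSpin n).sum_comp, Fintype.sum_prod_type]
  have hinit (b : VSpin n) (g : Fin N → VSpin n) :
      Fin.init ((Fin.snocEquiv fun _ => VSpin n) (b, g)) = g := by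
    funext j
    simp [Fin.init, Fin.snocEquiv]
  simp only [hinit, Fin.snocEquiv_apply, rowSum_succ, Fin.snoc_last, occupationProd, rowTransfer, Finset.mul_sum,
    Finset.smul_sum, Finset.sum_smul, mul_smul, mul_smul_comm]
  conv_lhs => enter [2, b]; rw [Finset.sum_comm]
  rw [Finset.sum_comm]

/-- The vector of factorial powers of exponent `m`. -/
def powerVec (y : ℕ → K) (x : Fin n → K) (m : ℕ) : Fin n → K := fun i => factorialPower y (x i) m

lemma factorialPower_succ (y : ℕ → K) (u : K) (m : ℕ) :
    factorialPower y u (m + 1) = factorialPower y u m * (u + y (m + 1)) := by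
  rw [factorialPower, Finset.prod_Icc_succ_top (by omega), factorialPower]

/-- The linear map that drops the first coordinate and scales the others by
`(x₀ - t xⱼ) / (x₀ - xⱼ)`. -/
def dropScale {k : ℕ} (t : K) (x : Fin (k + 1) → K) : (Fin (k + 1) → K) →ₗ[K] (Fin k → K) :=
  LinearMap.pi fun j =>
    ((x 0 - t * x j.succ) / (x 0 - x j.succ)) • LinearMap.proj j.succ

open ExteriorAlgebra in
/-- Contraction with the first coordinate, followed by `dropScale`. -/
noncomputable def removeRow {k : ℕ} (t : K) (x : Fin (k + 1) → K) :
    ExteriorAlgebra K (Fin (k + 1) → K) →ₗ[K] ExteriorAlgebra K (Fin k → K) :=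
  (map (dropScale t x)).toLinearMap ∘ₗ
    CliffordAlgebra.contractLeft (LinearMap.proj (0 : Fin (k + 1)))

open ExteriorAlgebra

lemma removeRow_ι_mul {k : ℕ} (t : K) (x : Fin (k + 1) → K) (v : Fin (k + 1) → K)
    (F : ExteriorAlgebra K (Fin (k + 1) → K)) :
    removeRow t x (ι K v * F) =
      v 0 • map (dropScale t x) F - ι K (dropScale t x v) * removeRow t x F := by
  simp only [removeRow, LinearMap.comp_apply]
  rw [ExteriorAlgebra.ι, CliffordAlgebra.contractLeft_ι_mul]
  simp [ExteriorAlgebra.ι]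

/-- The vector with coordinates `(xⱼ|y)^m / (x₀ - xⱼ)`, for `j ≥ 1`. -/
def quotVec {k : ℕ} (y : ℕ → K) (x : Fin (k + 1) → K) (m : ℕ) : Fin k → K :=
  fun j => factorialPower y (x j.succ) m / (x 0 - x j.succ)

/-- The scaling factor is `t + (1 - t)x₀/(x₀ - x_j)`. -/
lemma dropScale_powerVec {k : ℕ} (t : K) (y : ℕ → K) {x : Fin (k + 1) → K}
    (hx : Function.Injective x) (m : ℕ) :
    dropScale t x (powerVec y x m) =
      t • powerVec y (Fin.tail x) m + ((1 - t) * x 0) • quotVec y x m := by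
  ext j
  have h : x 0 - x j.succ ≠ 0 := sub_ne_zero.2 (hx.ne (Fin.succ_ne_zero j).symm)
  simp only [dropScale, powerVec, quotVec, LinearMap.pi_apply, LinearMap.smul_apply,
    LinearMap.proj_apply, smul_eq_mul, Pi.add_apply, Pi.smul_apply, Fin.tail]
  field_simp
  ring

/-- Write the new factor `x_j + y` as `(x₀ + y) - (x₀ - x_j)`. -/
lemma quotVec_succ {k : ℕ} (y : ℕ → K) {x : Fin (k + 1) → K}
    (hx : Function.Injective x) (m : ℕ) :
    quotVec y x (m + 1) =
      (x 0 + y (m + 1)) • quotVec y x m - powerVec y (Fin.tail x) m := by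
  ext j
  have h : x 0 - x j.succ ≠ 0 := sub_ne_zero.2 (hx.ne (Fin.succ_ne_zero j).symm)
  simp only [powerVec, quotVec, factorialPower_succ, smul_eq_mul, Pi.sub_apply, Pi.smul_apply,
    Fin.tail]
  field_simp
  ring

/-- Only an uncolored left edge occurs in the model; the colored case is carried along to close the
induction, which adds columns on the left. -/
theorem rowTransfer_eq {k : ℕ} (t : K) (y : ℕ → K) {x : Fin (k + 1) → K}
    (hx : Function.Injective x) (N : ℕ) (l : HSpin n) (top : Fin N → VSpin n) :
    rowTransfer t (x 0) y (fun m => ι K (powerVec y (Fin.tail x) m)) N l top =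
      hValue (removeRow t x (occupationProd (fun m => ι K (powerVec y x m)) N top))
        (factorialPower y (x 0) N •
            map (dropScale t x) (occupationProd (fun m => ι K (powerVec y x m)) N top) -
          ((1 - t) * x 0) • (ι K (quotVec y x N) *
            removeRow t x (occupationProd (fun m => ι K (powerVec y x m)) N top))) l := by
  induction N generalizing l with
  | zero =>
    rw [rowTransfer_zero]
    have h : removeRow t x 1 = 0 := by simp [removeRow]
    cases l <;> simp [occupationProd, h, factorialPower]
  | succ N ih =>
    rw [rowTransfer_succ]
    simp only [ih]
    change vertexSum t (x 0) (y (N + 1)) _ _ _ l (top (Fin.last N)) = _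
    rw [occupationProd]
    set F := occupationProd (fun m => ι K (powerVec y x m)) N (Fin.init top)
    set V := powerVec y (Fin.tail x) N with hV
    set Q := quotVec y x N with hQ
    have hW := dropScale_powerVec t y hx N
    have hQ' := quotVec_succ y hx N
    rw [← hV, ← hQ] at hW hQ'
    set E := removeRow t x F
    set H := map (dropScale t x) F
    have hVV : ι K V * ι K V = 0 := ι_sq_zero V
    have hQQ : ι K Q * ι K Q = 0 := ι_sq_zero Q
    have hQV : ι K Q * ι K V = - (ι K V * ι K Q) := eq_neg_of_add_eq_zero_left (ι_add_mul_swap Q V)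
    by_cases h0 : (top (Fin.last N)).card = 0
    · rw [Finset.card_eq_zero] at h0
      rw [h0, occupation_empty, one_mul]
      cases l with
      | none => rw [vertexSum_none_empty, hValue_none]
      | some c =>
        rw [vertexSum_some_empty, hValue_some, hQ', factorialPower_succ]
        simp only [map_sub, map_smul, sub_mul, smul_sub, smul_mul_assoc, smul_smul]
        module
    · by_cases h1 : (top (Fin.last N)).card = 1
      · obtain ⟨d, hd⟩ := Finset.card_eq_one.1 h1
        rw [hd, occupation_singleton, removeRow_ι_mul, map_mul, map_apply_ι, hW]
        cases l with
        | none =>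
          rw [vertexSum_none_singleton, hValue_none]
          simp only [map_add, map_smul, add_mul, smul_mul_assoc, powerVec]
          module
        | some c =>
          rw [vertexSum_some_singleton, hValue_some, hQ', factorialPower_succ]
          -- Anticommutation reduces both sides to `V * H` and `V * Q * E`; the `Q * H` terms
          -- cancel.
          have hVV' (z) : ι K V * (ι K V * z) = 0 := by rw [← mul_assoc, hVV, zero_mul]
          have hQQ' (z) : ι K Q * (ι K Q * z) = 0 := by rw [← mul_assoc, hQQ, zero_mul]
          have hQV' (z) : ι K Q * (ι K V * z) = - (ι K V * (ι K Q * z)) := by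
            rw [← mul_assoc, hQV, neg_mul, mul_assoc]
          simp only [map_add, map_sub, map_smul, add_mul, sub_mul, mul_add, mul_sub, smul_add,
            smul_sub, smul_mul_assoc, mul_smul_comm, smul_smul, hVV', hQQ', hQV', powerVec]
          module
      · have h2 : 2 ≤ (top (Fin.last N)).card := by omega
        rw [vertexSum_eq_zero _ _ _ _ _ _ _ h2, occupation_eq_zero _ h2]
        cases l <;> simp

end Row

open ExteriorAlgebra

/-! ### Iterating over the rows and evaluating by a determinant -/

section Evaluation

variable {K : Type*} [Field K] {n : ℕ}

/-- The iteration of `removeRow` over all rows. -/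
noncomputable def gridFunctional (t : K) :
    (k : ℕ) → (x : Fin k → K) → ExteriorAlgebra K (Fin k → K) →ₗ[K] K
  | 0, _ => algebraMapInv.toLinearMap
  | k + 1, x => gridFunctional t k (Fin.tail x) ∘ₗ removeRow t x

lemma occupationProd_eq_zero {A : Type*} [Ring A] {v : ℕ → A} (hv : ∀ m, v m = 0) (N : ℕ)
    (S : Fin N → VSpin n) :
    occupationProd v N S = if S = fun _ => ∅ then 1 else 0 := by
  induction N with
  | zero => rw [occupationProd, if_pos (Subsingleton.elim _ _)]
  | succ N ih =>
    rw [occupationProd, ih, hv]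
    have h : (S = fun _ => ∅) ↔ S (Fin.last N) = ∅ ∧ Fin.init S = fun _ => ∅ := by
      refine ⟨fun h => by subst h; exact ⟨rfl, rfl⟩, fun h => funext fun j => ?_⟩
      induction j using Fin.lastCases with
      | last => exact h.1
      | cast j => exact congrFun h.2 j
    by_cases h0 : S (Fin.last N) = ∅
    · simp [h, h0]
    · simp [h, h0, occupation]

/-- The grid sum as a functional of the ordered product of the top boundary. -/
theorem gridSum_eq (t : K) (y : ℕ → K) (N : ℕ) {k : ℕ} {x : Fin k → K}
    (hx : Function.Injective x) (top : Fin N → VSpin n) :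
    gridSum t y N x top =
      gridFunctional t k x (occupationProd (fun m => ι K (powerVec y x m)) N top) := by
  induction k generalizing top with
  | zero =>
    rw [gridSum_zero, gridFunctional, occupationProd_eq_zero]
    · split_ifs <;> simp
    · intro m
      rw [Subsingleton.elim (powerVec y x m) 0, map_zero]
  | succ k ih =>
    have hx' : Function.Injective (Fin.tail x) := hx.comp (Fin.succ_injective k)
    have h := rowTransfer_eq t y hx N none top
    rw [hValue_none] at h
    rw [gridSum_succ, gridFunctional, LinearMap.comp_apply, ← h, rowTransfer, map_sum]
    simp only [ih hx', map_smul, smul_eq_mul]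

lemma removeRow_prod_map_ι {k : ℕ} (t : K) (x : Fin (k + 1) → K) (l : List (Fin (k + 1) → K))
    (hl : ∀ v ∈ l, v 0 = 0) : removeRow t x (l.map (ι K)).prod = 0 := by
  induction l with
  | nil => simp [removeRow]
  | cons v l ih =>
    rw [List.map_cons, List.prod_cons, removeRow_ι_mul, ih fun w hw => hl w (by simp [hw]),
      hl v (by simp)]
    simp

/-- Contraction leaves only the term that removes `e₀`, and the remaining basis vectors are scaled
into the basis of the smaller space. -/
lemma gridFunctional_basis (t : K) (k : ℕ) (x : Fin k → K) :
    gridFunctional t k x (ιMulti K k (Pi.basisFun K (Fin k))) =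
      ∏ i : Fin k, ∏ j ∈ Finset.Ioi i, ((x i - t * x j) / (x i - x j)) := by
  induction k with
  | zero => simp [gridFunctional]
  | succ k ih =>
    have h : ∀ i : Fin k, dropScale t x (Pi.basisFun K (Fin (k + 1)) i.succ) =
        ((x 0 - t * x i.succ) / (x 0 - x i.succ)) • Pi.basisFun K (Fin k) i := by
      intro i
      ext j
      rcases eq_or_ne j i with rfl | hij
      · simp [dropScale]
      · simp [dropScale, hij]
    rw [gridFunctional, LinearMap.comp_apply, ιMulti_succ_apply, removeRow_ι_mul, ιMulti_apply,
      ← Function.comp_def (ι K), ← List.map_ofFn, removeRow_prod_map_ι]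
    · rw [List.map_ofFn, Function.comp_def, ← ιMulti_apply, map_apply_ιMulti]
      simp only [Function.comp_def, Matrix.vecTail, h]
      rw [AlternatingMap.map_smul_univ, mul_zero, sub_zero, map_smul, map_smul]
      have h := ih (Fin.tail x)
      simp only [Fin.tail] at h
      rw [Fin.prod_univ_succ, Fin.prod_Ioi_zero]
      simp only [Fin.prod_Ioi_succ, ← h]
      simp
    · intro v hv
      obtain ⟨i, rfl⟩ := List.mem_ofFn.1 hv
      simp [Matrix.vecTail]

lemma gridFunctional_ιMulti (t : K) (k : ℕ) (x : Fin k → K) (v : Fin k → Fin k → K) :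
    gridFunctional t k x (ιMulti K k v) =
      (∏ i : Fin k, ∏ j ∈ Finset.Ioi i, ((x i - t * x j) / (x i - x j))) *
        (Matrix.of fun i j => v j i).det := by
  have h := congrArg (fun f => f v) (((gridFunctional t k x).compAlternatingMap
    (ιMulti K k)).eq_smul_basis_det (Pi.basisFun K (Fin k)))
  simp only [LinearMap.compAlternatingMap_apply, AlternatingMap.smul_apply, smul_eq_mul,
    gridFunctional_basis, Module.Basis.det_apply] at h
  rw [h]
  congr 2

lemma occupationProd_eq_prod {A : Type*} [Ring A] (v : ℕ → A) (N : ℕ) {k : ℕ} (μ : Fin k → ℕ)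
    (hμ : StrictAnti μ) (hμN : ∀ i, μ i < N) (S : Fin N → VSpin n)
    (hS : ∀ j, (S j).card = if ∃ i, μ i = j then 1 else 0) :
    occupationProd v N S = (List.ofFn fun i => v (μ i)).prod := by
  induction N generalizing k with
  | zero =>
    cases k with
    | zero => simp [occupationProd]
    | succ k => exact absurd (hμN 0) (Nat.not_lt_zero _)
  | succ N ih =>
    rw [occupationProd, occupation]
    by_cases h : ∃ i, μ i = N
    · rw [hS (Fin.last N), Fin.val_last, if_pos h, if_neg one_ne_zero, if_pos rfl]
      obtain ⟨i, hi⟩ := h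
      cases k with
      | zero => exact i.elim0
      | succ k =>
        have h0 : μ 0 = N := by
          have h1 := hμ.antitone (Fin.zero_le i)
          have h2 := hμN 0
          omega
        have hlt (i : Fin k) : μ i.succ < N := h0 ▸ hμ (Fin.succ_pos i)
        rw [List.ofFn_succ, List.prod_cons, h0,
          ih (fun i => μ i.succ) (fun a b hab => hμ (Fin.succ_lt_succ_iff.2 hab)) hlt]
        intro j
        have : N ≠ j := j.2.ne'
        simp [Fin.init, hS, Fin.exists_fin_succ, h0, this]
    · rw [hS (Fin.last N), Fin.val_last, if_neg h, if_pos rfl, one_mul, ih μ hμ]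
      · intro i
        have h1 := hμN i
        have h2 : μ i ≠ N := fun h' => h ⟨i, h'⟩
        omega
      · intro j
        rw [Fin.init, hS, Fin.val_castSucc]

end Evaluation

/-! ### Conservation of colors -/

section Colors

variable {n : ℕ}

/-- Each color is conserved at an admissible vertex. -/
lemma AdmissibleVertex.color_conservation {l : HSpin n} {top : VSpin n} {r : HSpin n}
    {bot : VSpin n} (h : AdmissibleVertex l top r bot) (c : Fin n) :
    (if l = some c then 1 else 0) + (if c ∈ top then 1 else 0) =
      (if r = some c then 1 else 0) + (if c ∈ bot then 1 else 0 : ℕ) := by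
  unfold AdmissibleVertex at h
  rcases l with _ | a <;> rcases r with _ | b <;> simp only at h
  · subst h; simp
  · obtain ⟨h1, rfl⟩ := h
    by_cases hb : b = c
    · subst hb; simp [h1]
    · simp [hb, Ne.symm hb]
  · obtain ⟨h1, rfl⟩ := h
    by_cases hb : a = c
    · subst hb; simp [h1]
    · simp [hb, Ne.symm hb]
  · split_ifs at h with hab
    · subst hab; subst h; rfl
    · obtain ⟨h1, h2, rfl⟩ := h
      by_cases hac : a = c
      · subst hac; simp [h1, hab, Ne.symm hab]
      · by_cases hbc : b = c
        · subst hbc; simp [h2, hab]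
        · simp [hac, hbc, Ne.symm hac, Ne.symm hbc]

lemma IsAdmissibleState.exists_right_eq {N : ℕ} {B : Boundary n N} {s : DecoratedGrid n N}
    (hs : IsAdmissibleState B s) (hb : ∀ j, B.bottom j = ∅) {c : Fin n} {j : Fin N}
    (hc : c ∈ B.top j) : ∃ i, B.right i = some c := by
  obtain ⟨h1, h2, h3, h4, h5⟩ := hs
  by_contra! hne
  -- The two sums omit opposite ends of the row, and the omitted right end does not carry `c`. So
  -- the count of `c` on vertical edges cannot drop going down.
  have hH (i : Fin n) : ∑ j : Fin N, (if s.1 i j.castSucc = some c then 1 else 0) ≤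
      ∑ j : Fin N, (if s.1 i j.succ = some c then 1 else 0 : ℕ) := by
    have e1 := Fin.sum_univ_succ fun k : Fin (N + 1) => if s.1 i k = some c then 1 else 0
    have e2 := Fin.sum_univ_castSucc fun k : Fin (N + 1) => if s.1 i k = some c then 1 else 0
    rw [h2, if_neg (hne i)] at e1
    omega
  have hrow (i : Fin n) : ∑ j : Fin N, (if c ∈ s.2 i.castSucc j then 1 else 0) ≤
      ∑ j : Fin N, (if c ∈ s.2 i.succ j then 1 else 0 : ℕ) := by
    have h := Finset.sum_congr rfl fun j (_ : j ∈ Finset.univ) =>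
      (h5 i j).color_conservation c
    rw [Finset.sum_add_distrib, Finset.sum_add_distrib] at h
    have := hH i
    omega
  have hmono : Monotone fun k : Fin (n + 1) => ∑ j : Fin N, if c ∈ s.2 k j then 1 else 0 :=
    Fin.monotone_iff_le_succ.2 hrow
  have h := hmono (Fin.zero_le (Fin.last n))
  simp only [h1, h3, hb, Finset.notMem_empty, if_false, Finset.sum_const_zero] at h
  have h' := Finset.single_le_sum (f := fun j => if c ∈ B.top j then 1 else 0)
    (fun _ _ => Nat.zero_le _) (Finset.mem_univ j)
  simp only [hc, if_true] at h'
  omega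

end Colors

/-! ### From partition functions to grid sums -/

section Main

variable {K : Type*} [Field K] {n : ℕ}

lemma sum_partitionFunction_right (t : K) (y : ℕ → K) (N : ℕ) (x : Fin n → K)
    (top : Fin N → VSpin n) :
    ∑ w : Fin n → Fin n, partitionFunction t x y
        ⟨top, fun i => some (w i), fun _ => ∅, fun _ => none⟩ = gridSum t y N x top := by
  simp only [partitionFunction, Finset.sum_filter, Fintype.sum_prod_type]
  rw [Finset.sum_comm]
  have hgrid : gridSum t y N x top = ∑ h : Fin n → Fin (N + 1) → HSpin n,
      ∑ v : Fin (n + 1) → Fin N → VSpin n, if v 0 = top ∧ v (Fin.last n) = fun _ => ∅ then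
        ∏ i, (if h i (Fin.last N) = none then hValue 0 1 (h i 0) * ∏ j : Fin N,
          vertexWeight t (x i) (y (j + 1)) (h i j.succ) (v i.castSucc j) (h i j.castSucc)
            (v i.succ j) else 0) else 0 := by
    rw [gridSum, Finset.sum_comm]
    refine Finset.sum_congr rfl fun v _ => ?_
    split_ifs with hv
    · simp only [rowSum, Finset.prod_univ_sum, Fintype.piFinset_univ]
    · simp
  rw [hgrid]
  refine Finset.sum_congr rfl fun h _ => ?_
  rw [Finset.sum_comm]
  refine Finset.sum_congr rfl fun v _ => ?_
  by_cases hc : ∀ i, ∃ c, h i 0 = some c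
  · choose w hw using hc
    rw [Finset.sum_eq_single w]
    · simp only [hw, hValue_some, one_mul]
      by_cases htop : v 0 = top ∧ v (Fin.last n) = fun _ => ∅
      · rw [if_pos htop]
        by_cases hleft : ∀ i, h i (Fin.last N) = none
        · simp only [hleft, if_true]
          by_cases hadm : ∀ (i : Fin n) (j : Fin N), AdmissibleVertex (h i j.succ)
              (v i.castSucc j) (h i j.castSucc) (v i.succ j)
          · rw [if_pos ⟨fun j => congrFun htop.1 j, hw, fun j => congrFun htop.2 j, hleft, hadm⟩]
            simp only [vertexWeight, hadm, if_true]
          · rw [if_neg fun hs => hadm hs.2.2.2.2]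
            push Not at hadm
            obtain ⟨i, j, hij⟩ := hadm
            refine (Finset.prod_eq_zero (Finset.mem_univ i)
              (Finset.prod_eq_zero (Finset.mem_univ j) ?_)).symm
            rw [vertexWeight, if_neg hij]
        · rw [if_neg fun hs => hleft hs.2.2.2.1]
          push Not at hleft
          obtain ⟨i, hi⟩ := hleft
          exact (Finset.prod_eq_zero (Finset.mem_univ i) (if_neg hi)).symm
      · rw [if_neg htop, if_neg fun hs => htop ⟨funext hs.1, funext hs.2.2.1⟩]
    · intro w' _ hne
      rw [if_neg fun hs => hne (funext fun i => Option.some_injective _ ?_)]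
      exact (hs.2.1 i).symm.trans (hw i)
    · simp
  · push Not at hc
    obtain ⟨i, hi⟩ := hc
    rw [Finset.sum_eq_zero fun w _ => if_neg fun hs => hi _ (hs.2.1 i)]
    have h0 : h i 0 = none := Option.eq_none_iff_forall_ne_some.2 hi
    rw [Finset.prod_eq_zero (Finset.mem_univ i) (by simp [h0]), ite_self]

lemma card_boundary_top {N : ℕ} (σ w : Equiv.Perm (Fin n)) {μ : Fin n → ℕ}
    (hμ : Function.Injective μ) (j : Fin N) :
    ((boundary N σ w μ).top j).card = if ∃ i, μ i = j + 1 then 1 else 0 := by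
  rw [boundary, Finset.card_image_of_injective _ fun a b h => Fin.rev_injective (σ.injective h)]
  split_ifs with h
  · obtain ⟨i, hi⟩ := h
    rw [Finset.card_eq_one]
    refine ⟨i, ?_⟩
    ext a
    simp only [Finset.mem_filter, Finset.mem_univ, true_and, Finset.mem_singleton, ← hi, hμ.eq_iff]
  · rw [Finset.card_eq_zero, Finset.filter_eq_empty_iff]
    exact fun i _ hi => h ⟨i, hi⟩

/-- Only the permutations contribute to the sum over all colorings of the right boundary. -/
lemma sum_Omega_eq_gridSum (t : K) (y : ℕ → K) (N : ℕ) (x : Fin n → K) (σ : Equiv.Perm (Fin n))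
    {μ : Fin n → ℕ} (hμ : ∀ i, 1 ≤ μ i) (hμN : ∀ i, μ i ≤ N) :
    ∑ w, Omega N t x y σ w μ = gridSum t y N x (boundary N σ 1 μ).top := by
  rw [← sum_partitionFunction_right]
  refine Fintype.sum_of_injective (fun w : Equiv.Perm (Fin n) => (w : Fin n → Fin n))
    DFunLike.coe_injective _ _ ?_ fun w => rfl
  intro w hw
  -- A single admissible state forces `w` to be surjective, as every color occurs on top and must
  -- leave on the right.
  refine Finset.sum_eq_zero fun s hs => absurd ?_ hw
  have hsurj : Function.Surjective w := by
    intro c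
    have hi := hμ (σ.symm c).rev
    have hi' := hμN (σ.symm c).rev
    have hc : c ∈ (boundary N σ 1 μ).top ⟨μ (σ.symm c).rev - 1, by omega⟩ := by
      refine Finset.mem_image.2 ⟨(σ.symm c).rev, Finset.mem_filter.2 ⟨Finset.mem_univ _, ?_⟩, ?_⟩
      · simp only; omega
      · simp
    obtain ⟨i, hi⟩ := (Finset.mem_filter.1 hs).2.exists_right_eq (fun _ => rfl) hc
    exact ⟨i, Option.some_injective _ hi⟩
  exact ⟨Equiv.ofBijective w (Finite.injective_iff_bijective.1
    (Finite.injective_iff_surjective.2 hsurj)), rfl⟩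

end Main

end DoubleWhittaker

open DoubleWhittaker in
theorem theorem8p3 {K : Type*} [Field K] (n N : ℕ) (t : K) (x : Fin n → K)
    (hx : Function.Injective x) (y : ℕ → K) (lam : Fin n → ℕ) (hlam : Antitone lam)
    (hN : ∀ i, lam i + DoubleWhittaker.rho n i ≤ N) (σ : Equiv.Perm (Fin n)) :
    ∑ w : Equiv.Perm (Fin n), DoubleWhittaker.Omega N t x y σ w (lam + DoubleWhittaker.rho n)
      = (∏ i : Fin n, ∏ j ∈ Finset.Ioi i, (x i - t * x j))
          * DoubleWhittaker.factorialSchur lam x y := by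
  have hμ : StrictAnti (lam + rho n) := fun a b hab => by
    have h := hlam hab.le
    simp only [Pi.add_apply, rho]
    have := Fin.lt_def.1 hab
    omega
  -- Column `μ_i` carries the factorial power of exponent `μ_i - 1`.
  have hpos (i : Fin n) : (lam + rho n) i = lam i + (n - (i + 1)) + 1 := by
    simp only [Pi.add_apply, rho]
    omega
  rw [sum_Omega_eq_gridSum (μ := lam + rho n) t y N x σ (fun i => by rw [hpos]; omega) hN, gridSum_eq t y N hx,
    occupationProd_eq_prod _ N (fun i => lam i + (n - ((i : ℕ) + 1))),
    ← ExteriorAlgebra.ιMulti_apply, gridFunctional_ιMulti, factorialSchur]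
  · simp only [Finset.prod_div_distrib]
    rw [div_mul_eq_mul_div, mul_div_assoc]
    rfl
  · intro a b hab
    have h := hμ hab
    rw [hpos, hpos] at h
    simpa using h
  · intro i
    have h := hN i
    have h' := hpos i
    simp only [Pi.add_apply] at h'
    omega
  · intro j
    rw [card_boundary_top _ _ hμ.injective]
    simp only [hpos, Nat.add_right_cancel_iff]
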